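/- Let $\mathbb{T}^d=\mathbb{R}^d/\mathbb{Z}^d$ be the flat torus, let $V\in C^2(\mathbb{T}^d)$, and let $\alpha[0]\in\mathbb{R}$ be the critical constant of $H(x,p)=\frac12|p|^2+V(x)$, i.e. the unique constant $c$ for which $\frac12|Du|^2+V=c$ has a semiconcave viscosity solution on $\mathbb{T}^d$. Here a continuous function $u:\mathbb{T}^d\to\mathbb{R}$ is called semiconcave if there is $C>0$ such that (for the periodic lift of $u$ to $\mathbb{R}^d$) $$\lambda u(x)+(1-\lambda)u(y)-u(\lambda x+(1-\lambda)y)\le \tfrac C2\lambda(1-\lambda)|x-y|^2\qquad\text{for all }x,y\in\mathbb{R}^d,\ \lambda\in[0,1].$$ Let $u:\mathbb{T}^d\to\mathbb{R}$ be a semiconcave viscosity solution of $$\tfrac12|Du(x)|^2+V(x)=\alpha[0]\qquad(x\in\mathbb{T}^d).$$ Let $D^+u(x)=\{p\in\mathbb{R}^d:\limsup_{y\to x}\frac{u(y)-u(x)-\langle p,y-x\rangle}{|y-x|}\le 0\}$ be the superdifferential of $u$, and $\mathrm{Crit}(u)=\{x\in\mathbb{T}^d: 0\in D^+u(x)\}$.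 For $x\in\mathbb{T}^d$ let $t\mapsto\mathbf{x}_u(t,x)$, $t\ge 0$, be the generalised gradient flow of $u$, i.e. the unique locally Lipschitz curve with $\mathbf{x}_u(0,x)=x$ and $\dot{\mathbf{x}}_u(t,x)\in D^+u(\mathbf{x}_u(t,x))$ for a.e. $t\ge 0$, and let $\tau(x)=\inf\{t\ge 0:\mathbf{x}_u(t,x)\in\mathrm{Crit}(u)\}\in[0,\infty]$ be the critical time of $x$. For $T>0$ let $\mu^T_x$ be the probability measure on $\mathbb{T}^d$ with $\int f\,d\mu_x^T=\frac1T\int_0^T f(\mathbf{x}_u(t,x))\,dt$ for all $f\in C(\mathbb{T}^d)$, and let $\mathcal{W}_u(x)$ be the set of all probability measures on $\mathbb{T}^d$ that are weak limits of $\mu_x^{T_k}$ for some sequence $T_k\uparrow\infty$. Let $M(V)=\arg\max_{\mathbb{T}^d}V$, and let $d_{M(V)}(y)$ be the distance of $y$ from $M(V)$. Let $x\in\mathbb{T}^d$ be such that $\tau(x)=\infty$. Then the following properties are equivalent: (a) for any $\mu\in\mathcal{W}_u(x)$ we have $\displaystyle\int_{\mathbb{T}^d}V(y)\,d\mu(y)=\alpha[0]$;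 (b) for any $\varepsilon>0$ we have $$\lim_{T\to\infty}\frac1T\,\mathcal{L}^1\Big(\big\{t\in[0,T]: d_{M(V)}\big(\mathbf{x}_u(t,x)\big)\ge\varepsilon\big\}\Big)=0.$$ -/

import Mathlib

open MeasureTheory Filter Topology Set
open scoped NNReal ENNReal

noncomputable section

namespace MechHJ

/-- The Euclidean space `ℝ^d`. -/
abbrev E (d : ℕ) : Type := EuclideanSpace ℝ (Fin d)

/-- The flat torus `𝕋^d = ℝ^d / ℤ^d`, with its flat (Euclidean) distance. -/
abbrev Torus (d : ℕ) : Type := PiLp 2 (fun _ : Fin d => UnitAddCircle)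

variable {d : ℕ}

/-- The canonical projection `ℝ^d → 𝕋^d`. -/
def proj (v : E d) : Torus d := WithLp.toLp 2 (fun i => ((v i : ℝ) : UnitAddCircle))

/-- `f ∈ C^n(𝕋^d)`: the `ℤ^d`-periodic lift of `f` to `ℝ^d` is of class `C^n`. -/
def IsCk (n : ℕ) (f : Torus d → ℝ) : Prop :=
  ContDiff ℝ n (fun v : E d => f (proj v))

/-- The gradient at `x` of a differentiable function on the torus. -/
def torusGradient (f : Torus d → ℝ) (x : Torus d) : E d :=
  gradient (fun h : E d => f (x + proj h)) 0

/-- Semiconcavity with linear modulus, for functions on the torus (segments and distances are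
those of the universal cover `ℝ^d`). -/
def Semiconcave (u : Torus d → ℝ) : Prop :=
  Continuous u ∧ ∃ C : ℝ, 0 < C ∧ ∀ (x y : E d) (l : ℝ), l ∈ Icc (0 : ℝ) 1 →
    l * u (proj x) + (1 - l) * u (proj y) - u (proj (l • x + (1 - l) • y))
      ≤ C / 2 * l * (1 - l) * ‖x - y‖ ^ 2

/-- The superdifferential `D⁺u(x)`: the vectors `p` with
`limsup_{h → 0} (u (x + h) - u x - ⟨p, h⟩) / |h| ≤ 0`. -/
def superdiff (u : Torus d → ℝ) (x : Torus d) : Set (E d) :=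
  {p | ∀ ε : ℝ, 0 < ε → ∀ᶠ h : E d in 𝓝 0, u (x + proj h) - u x - inner ℝ p h ≤ ε * ‖h‖}

/-- The mechanical Hamiltonian `H(x, p) = |p|² / 2 + V(x)`. -/
def hamiltonian (V : Torus d → ℝ) (x : Torus d) (p : E d) : ℝ := 1 / 2 * ‖p‖ ^ 2 + V x

/-- `u` is a viscosity solution on the torus of `|Du|² / 2 + V = c`. -/
structure IsViscositySolution (V : Torus d → ℝ) (c : ℝ) (u : Torus d → ℝ) : Prop where
  continuous : Continuous u
  subsolution : ∀ (x : Torus d) (φ : Torus d → ℝ), IsCk 1 φ →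
    (∀ y, u y - φ y ≤ u x - φ x) → hamiltonian V x (torusGradient φ x) ≤ c
  supersolution : ∀ (x : Torus d) (φ : Torus d → ℝ), IsCk 1 φ →
    (∀ y, u x - φ x ≤ u y - φ y) → c ≤ hamiltonian V x (torusGradient φ x)

/-- The critical constant `α[0]` of the mechanical Hamiltonian: the unique `c` for which
`|Du|² / 2 + V = c` has a semiconcave viscosity solution on the torus (so that the set below has
exactly one element). -/
def criticalConstant (V : Torus d → ℝ) : ℝ :=
  sInf {c : ℝ | ∃ w : Torus d → ℝ, Semiconcave w ∧ IsViscositySolution V c w}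

/-- The critical set `Crit(u) = {x : 0 ∈ D⁺u(x)}`. -/
def criticalSet (u : Torus d → ℝ) : Set (Torus d) := {x | (0 : E d) ∈ superdiff u x}

/-- `γ` solves `γ'(t) ∈ D⁺u(γ(t))` for a.e. `t ≥ 0`, `γ(0) = x`. The locally Lipschitz curve `γ`
on `[0, ∞)` is described by a lift `ξ` to `ℝ^d`, whose derivative is the velocity of `γ`. -/
def IsGradientCurve (u : Torus d → ℝ) (x : Torus d) (γ : ℝ → Torus d) : Prop :=
  γ 0 = x ∧ ∃ ξ : ℝ → E d,
    (∀ T : ℝ, ∃ K : ℝ≥0, LipschitzOnWith K ξ (Icc 0 T)) ∧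
    (∀ t : ℝ, 0 ≤ t → γ t = proj (ξ t)) ∧
    ∀ᵐ t : ℝ, 0 < t → ∃ p ∈ superdiff u (γ t), HasDerivAt ξ p t

open Classical in
/-- The generalised gradient flow `x_u(t, x)`, `t ≥ 0`: the solution of
`γ'(t) ∈ D⁺u(γ(t))`, `γ(0) = x`, which exists and is unique on `[0, ∞)` whenever `u` is
semiconcave. (The value `x` for functions `u` without such a solution is a convention, as are the
values at `t < 0`, which are never used.) -/
def flow (u : Torus d → ℝ) (t : ℝ) (x : Torus d) : Torus d :=
  if h : ∃ γ : ℝ → Torus d, IsGradientCurve u x γ then h.choose t else x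

/-- The critical time `τ(x) = inf {t ≥ 0 : x_u(t, x) ∈ Crit(u)} ∈ [0, ∞]`. -/
def criticalTime (u : Torus d → ℝ) (x : Torus d) : ℝ≥0∞ :=
  ⨅ (t : ℝ≥0) (_ : flow u t x ∈ criticalSet u), (t : ℝ≥0∞)

/-- The individual occupational measure `μ_x^T` of `x_u(·, x)` on `[0, T]`: the image under
`t ↦ x_u(t, x)` of the normalised Lebesgue measure on `[0, T]`. -/
def occupationalMeasure (u : Torus d → ℝ) (x : Torus d) (T : ℝ) : Measure (Torus d) :=
  (ENNReal.ofReal T)⁻¹ • (volume.restrict (Icc 0 T)).map (fun t : ℝ => flow u t x)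

/-- The family `W_u(x)` of all (limiting) occupational measures: the probability measures that
are weak limits of `μ_x^{T_k}` along some sequence `T_k ↑ ∞`. -/
def limitingMeasures (u : Torus d → ℝ) (x : Torus d) : Set (ProbabilityMeasure (Torus d)) :=
  {μ | ∃ T : ℕ → ℝ, (∀ k, 0 < T k) ∧ Monotone T ∧ Tendsto T atTop atTop ∧
    ∀ f : C(Torus d, ℝ), Tendsto (fun k => ∫ y, f y ∂(occupationalMeasure u x (T k))) atTop
      (𝓝 (∫ y, f y ∂(μ : Measure (Torus d))))}

/-- `M(V) = argmax V`. -/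
def argmaxSet (V : Torus d → ℝ) : Set (Torus d) := {x | ∀ y, V y ≤ V x}

end MechHJ

end

/-!
The critical constant of `|p|² / 2 + V` is `max V`. A viscosity solution `u` at level `c` satisfies
`V x ≤ c` at every point where a `C¹` function touches `u` from above, and such points are dense;
conversely a constant touches `u` from below at a minimum point, which gives `c ≤ V` there
(`IsViscositySolution.le_level`, `IsViscositySolution.exists_level_le`).

Both properties then say that the averages `∫ V dμ_x^T` converge to `max V`.

* The occupational measures are probability measures on a compact metrizable space, so any sequence
  `T_k → ∞` has a subsequence along which they converge weakly. Hence `∫ V dμ = c` for all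
  limiting measures `μ` if and only if `∫ V dμ_x^T → c` (`forall_limitingMeasures_integral_eq_iff`).
* As `V ≤ c` with equality exactly on `M(V)`, compactness makes `c - V` bounded below by a positive
  constant away from `M(V)` and small near `M(V)`. Hence `∫ V dμ_x^T → c` if and only if the mass
  which `μ_x^T` puts at distance at least `ε` from `M(V)` tends to `0` for all `ε > 0`
  (`tendsto_integral_iff_tendsto_measureReal`). That mass is the fraction of the time interval
  `[0, T]` spent there (`measureReal_occupationalMeasure`).

The only property of the flow which enters is the continuity of its trajectories.
-/

open MeasureTheory Filter Topology Set
open scoped NNReal ENNReal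

/-! ### Mass away from the set of maximum points -/

/-- If `V ≤ c` on a compact space, with equality exactly on `M`, then `V` has averages tending to
`c` precisely when the averaging measures concentrate on `M`. -/
theorem tendsto_integral_iff_tendsto_measureReal {X ι : Type*} [PseudoMetricSpace X]
    [CompactSpace X] [MeasurableSpace X] [BorelSpace X] {l : Filter ι} {ν : ι → Measure X}
    (hν : ∀ᶠ i in l, IsProbabilityMeasure (ν i)) {V : X → ℝ} (hV : Continuous V) {c : ℝ}
    (hle : ∀ y, V y ≤ c) {M : Set X} (hM : ∀ y, y ∈ M ↔ V y = c) (hne : M.Nonempty) :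
    Tendsto (fun i => ∫ y, V y ∂(ν i)) l (𝓝 c) ↔
      ∀ ε : ℝ, 0 < ε → Tendsto (fun i => (ν i).real {y | ε ≤ Metric.infDist y M}) l (𝓝 0) := by
  have hclosed : IsClosed M := by
    have : M = V ⁻¹' {c} := by ext y; simp [hM]
    rw [this]
    exact isClosed_singleton.preimage hV
  have hdist : Continuous fun y => Metric.infDist y M := Metric.continuous_infDist_pt M
  have hS : ∀ ε, IsClosed {y | ε ≤ Metric.infDist y M} := fun ε =>
    isClosed_le continuous_const hdist
  have hint : ∀ (m : Measure X) [IsProbabilityMeasure m], Integrable V m := fun m _ => by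
    obtain ⟨C, hC⟩ := (isCompact_range hV).isBounded.exists_norm_le
    exact Integrable.of_bound hV.aestronglyMeasurable C
      (Eventually.of_forall fun y => hC _ (mem_range_self y))
  have hsub : ∀ (m : Measure X) [IsProbabilityMeasure m],
      ∫ y, (c - V y) ∂m = c - ∫ y, V y ∂m := fun m _ => by
    rw [integral_sub (integrable_const c) (hint m)]
    simp
  constructor
  · intro h ε hε
    obtain ⟨η, hη, hηle⟩ := (hS ε).isCompact.exists_forall_le' (f := fun y => c - V y)
      (continuous_const.sub hV).continuousOn (a := 0) (fun y hy => by
        refine sub_pos.2 (lt_of_le_of_ne (hle y) fun heq => ?_)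
        have h0 : Metric.infDist y M = 0 := Metric.infDist_zero_of_mem ((hM y).2 heq)
        have hy' : ε ≤ Metric.infDist y M := hy
        linarith)
    have hlim : Tendsto (fun i => (c - ∫ y, V y ∂(ν i)) / η) l (𝓝 0) := by
      simpa using (h.const_sub c).div_const η
    refine tendsto_of_tendsto_of_tendsto_of_le_of_le' tendsto_const_nhds hlim
      (Eventually.of_forall fun i => measureReal_nonneg) ?_
    filter_upwards [hν] with i hi
    rw [le_div_iff₀ hη, ← hsub]
    have hind : ∫ y, indicator {y | ε ≤ Metric.infDist y M} (fun _ => η) y ∂(ν i)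
        = (ν i).real {y | ε ≤ Metric.infDist y M} * η := by
      rw [integral_indicator_const _ (hS ε).measurableSet, smul_eq_mul]
    rw [← hind]
    refine integral_mono ((integrable_const η).indicator (hS ε).measurableSet)
      ((integrable_const c).sub (hint _)) fun y => ?_
    by_cases hy : y ∈ {y | ε ≤ Metric.infDist y M}
    · simpa only [indicator_of_mem hy] using hηle y hy
    · simpa only [indicator_of_notMem hy] using sub_nonneg.2 (hle y)
  · intro h
    obtain ⟨C, hC⟩ := (isCompact_range (continuous_const.sub hV : Continuous fun y => c - V y))
      |>.isBounded.exists_norm_le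
    have hCb : ∀ y, c - V y ≤ C := fun y => (le_abs_self _).trans (hC _ (mem_range_self y))
    refine tendsto_order.2 ⟨fun a ha => ?_, fun a ha => ?_⟩
    · -- Half of the admissible error is used near `M`, the other half far from `M`.
      set η := (c - a) / 2 with hηdef
      have hη : 0 < η := by rw [hηdef]; linarith
      have hK : IsClosed {y | V y ≤ c - η} := isClosed_le hV continuous_const
      obtain ⟨ε, hε, hεle⟩ := hK.isCompact.exists_forall_le'
        (f := fun y => Metric.infDist y M) hdist.continuousOn (a := 0) (fun y hy => by
          refine (hclosed.notMem_iff_infDist_pos hne).1 fun hyM => ?_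
          have hy' : V y ≤ c - η := hy
          have := (hM y).1 hyM
          linarith)
      have hlim : Tendsto (fun i => (ν i).real {y | ε ≤ Metric.infDist y M} * C) l (𝓝 0) := by
        simpa using (h ε hε).mul_const C
      filter_upwards [hν, hlim.eventually_lt_const hη] with i hi hsmall
      have hindi : Integrable (indicator {y | ε ≤ Metric.infDist y M} (fun _ => C)) (ν i) :=
        (integrable_const C).indicator (hS ε).measurableSet
      have hbound : ∫ y, (c - V y) ∂(ν i)
          ≤ ∫ y, (η + indicator {y | ε ≤ Metric.infDist y M} (fun _ => C) y) ∂(ν i) := by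
        refine integral_mono ((integrable_const c).sub (hint _))
          ((integrable_const η).add hindi) fun y => ?_
        by_cases hy : y ∈ {y | ε ≤ Metric.infDist y M}
        · simp only [indicator_of_mem hy]
          linarith [hCb y]
        · simp only [indicator_of_notMem hy]
          have : ¬ V y ≤ c - η := fun hyV => hy (hεle y hyV)
          linarith
      rw [hsub, integral_add (integrable_const η) hindi,
        integral_indicator_const _ (hS ε).measurableSet, smul_eq_mul] at hbound
      simp only [integral_const, probReal_univ, one_smul] at hbound
      linarith
    · filter_upwards [hν] with i hi
      have : 0 ≤ ∫ y, (c - V y) ∂(ν i) := integral_nonneg fun y => sub_nonneg.2 (hle y)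
      rw [hsub] at this
      linarith

namespace MechHJ

variable {d : ℕ}

/-! ### The torus -/

instance : CompactSpace (Torus d) :=
  (PiLp.homeomorph 2 (fun _ : Fin d => UnitAddCircle)).symm.compactSpace

theorem continuous_proj : Continuous (proj : E d → Torus d) := by
  refine (PiLp.continuous_toLp 2 _).comp (continuous_pi fun i => ?_)
  exact (AddCircle.continuous_mk' 1).comp (PiLp.continuous_apply 2 _ i)

theorem proj_surjective : Function.Surjective (proj : E d → Torus d) := by
  intro z
  choose v hv using fun i => QuotientAddGroup.mk_surjective (z i)
  exact ⟨WithLp.toLp 2 v, PiLp.ext hv⟩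

theorem isOpenMap_proj : IsOpenMap (proj : E d → Torus d) := by
  have h : IsOpenMap (Pi.map fun (_ : Fin d) (s : ℝ) => (s : UnitAddCircle)) :=
    IsOpenMap.piMap (fun _ => QuotientAddGroup.isOpenMap_coe)
      (Eventually.of_forall fun _ => QuotientAddGroup.mk_surjective)
  exact (PiLp.homeomorph 2 (fun _ : Fin d => UnitAddCircle)).symm.isOpenMap.comp
    (h.comp (PiLp.homeomorph 2 (fun _ : Fin d => ℝ)).isOpenMap)

theorem IsCk.continuous {n : ℕ} {f : Torus d → ℝ} (hf : IsCk n f) : Continuous f :=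
  (isOpenMap_proj.isQuotientMap continuous_proj proj_surjective).continuous_iff.2
    (ContDiff.continuous hf)

/-- The function `∑ i, (1 - cos (2π (z i - y i)))` on the torus: it is smooth, nonnegative, and
vanishes only at `y`. -/
noncomputable def bump (y z : Torus d) : ℝ := ∑ i, (1 - (fourier 1 (z i - y i) : ℂ).re)

theorem bump_self (y : Torus d) : bump y y = 0 := by
  simp [bump]

theorem re_fourier_le_one (a : UnitAddCircle) : (fourier 1 a : ℂ).re ≤ 1 := by
  refine (Complex.re_le_norm _).trans (le_of_eq ?_)
  rw [fourier_apply, Circle.norm_coe]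

theorem bump_nonneg (y z : Torus d) : 0 ≤ bump y z :=
  Finset.sum_nonneg fun _ _ => sub_nonneg.2 (re_fourier_le_one _)

theorem eq_of_bump_eq_zero {y z : Torus d} (h : bump y z = 0) : z = y := by
  have h' := (Finset.sum_eq_zero_iff_of_nonneg fun i _ =>
    sub_nonneg.2 (re_fourier_le_one (z i - y i))).1 h
  refine PiLp.ext fun i => sub_eq_zero.1 ?_
  apply AddCircle.injective_toCircle one_ne_zero
  have hre : (fourier 1 (z i - y i) : ℂ).re = 1 := by linarith [h' i (Finset.mem_univ i)]
  have hnorm : ‖(fourier 1 (z i - y i) : ℂ)‖ = 1 := by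
    rw [fourier_apply, Circle.norm_coe]
  -- A complex number of norm one with real part one is one.
  have hone : (fourier 1 (z i - y i) : ℂ) = 1 := by
    have him : (fourier 1 (z i - y i) : ℂ).im = 0 := by
      have hsq := Complex.sq_norm (fourier 1 (z i - y i) : ℂ)
      rw [hnorm, Complex.normSq_apply, hre] at hsq
      nlinarith
    exact Complex.ext (by simpa using hre) (by simpa using him)
  rw [fourier_apply, one_zsmul] at hone
  rw [AddCircle.toCircle_zero]
  exact Subtype.ext hone

theorem isCk_bump (n : ℕ) (k : ℝ) (y : Torus d) : IsCk n (fun z => k * bump y z) := by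
  obtain ⟨w, rfl⟩ := proj_surjective y
  have h : (fun v : E d => k * bump (proj w) (proj v))
      = fun v : E d => k * ∑ i, (1 - Real.cos (2 * Real.pi * (v i - w i))) := by
    funext v
    simp only [bump]
    congr 1
    refine Finset.sum_congr rfl fun i _ => ?_
    have hcoe : (proj v : Torus d) i - (proj w : Torus d) i
        = ((v i - w i : ℝ) : UnitAddCircle) := rfl
    have harg : (2 * Real.pi * Complex.I * ((1 : ℤ) : ℂ) * ((v i - w i : ℝ) : ℂ) / ((1 : ℝ) : ℂ))
        = ((2 * Real.pi * (v i - w i) : ℝ) : ℂ) * Complex.I := by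
      push_cast
      ring
    rw [hcoe, fourier_coe_apply, harg, Complex.exp_ofReal_mul_I_re]
  unfold IsCk
  rw [h]
  fun_prop

theorem continuous_bump (y : Torus d) : Continuous (bump y) := by
  simpa using (isCk_bump 0 1 y).continuous

/-! ### The level of a viscosity solution is the maximum of the potential -/

/-- The penalised functions `u - k * bump y` have maximum points arbitrarily near `y`, and `V ≤ c`
at each of these by the subsolution property, whatever the gradient of the test function is. -/
theorem IsViscositySolution.le_level {V u : Torus d → ℝ} {c : ℝ} (hV : Continuous V)
    (hu : IsViscositySolution V c u) (y : Torus d) : V y ≤ c := by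
  by_contra! hy
  have hK : IsClosed {z | V z ≤ c} := isClosed_le hV continuous_const
  obtain ⟨m, hm, hmle⟩ := hK.isCompact.exists_forall_le' (f := bump y)
    (continuous_bump y).continuousOn (a := 0) (fun z hz => by
      refine lt_of_le_of_ne (bump_nonneg y z) fun h0 => ?_
      have hzy := eq_of_bump_eq_zero h0.symm
      have hz' : V z ≤ c := hz
      rw [hzy] at hz'
      linarith)
  obtain ⟨C, hC⟩ := (isCompact_range hu.continuous).isBounded.exists_norm_le
  have hCu : ∀ z, |u z| ≤ C := fun z => hC _ (mem_range_self z)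
  -- With this factor the penalty exceeds the oscillation of `u` on `{V ≤ c}`.
  set k := (2 * C + 1) / m with hk
  have hC0 : 0 ≤ C := (abs_nonneg _).trans (hCu y)
  have hk0 : 0 ≤ k := by positivity
  obtain ⟨z, -, hz⟩ := isCompact_univ.exists_isMaxOn (univ_nonempty (α := Torus d))
    (hu.continuous.sub (continuous_const.mul (continuous_bump y))
      : Continuous fun z => u z - k * bump y z).continuousOn
  have hmax : ∀ z', u z' - k * bump y z' ≤ u z - k * bump y z := fun z' => hz (mem_univ z')
  have hVz : V z ≤ c := by
    have h := hu.subsolution z _ (isCk_bump 1 k y) hmax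
    unfold hamiltonian at h
    nlinarith [sq_nonneg ‖torusGradient (fun z => k * bump y z) z‖]
  have hlarge : 2 * C + 1 ≤ k * bump y z := by
    have h1 : k * m = 2 * C + 1 := by rw [hk]; field_simp
    have h2 := mul_le_mul_of_nonneg_left (hmle z hVz) hk0
    linarith
  have h1 := hmax y
  rw [bump_self, mul_zero, sub_zero] at h1
  have h2 := abs_le.1 (hCu y)
  have h3 := abs_le.1 (hCu z)
  linarith

theorem IsViscositySolution.exists_level_le {V u : Torus d → ℝ} {c : ℝ}
    (hu : IsViscositySolution V c u) : ∃ y, c ≤ V y := by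
  obtain ⟨y, -, hy⟩ := isCompact_univ.exists_isMinOn (univ_nonempty (α := Torus d))
    hu.continuous.continuousOn
  refine ⟨y, ?_⟩
  have h := hu.supersolution y (fun _ => 0) contDiff_const
    (fun z => by simpa using hy (mem_univ z))
  simpa [hamiltonian, torusGradient] using h

/-! ### Occupational measures -/

theorem continuousOn_flow (u : Torus d → ℝ) (x : Torus d) (T : ℝ) :
    ContinuousOn (fun t => flow u t x) (Icc 0 T) := by
  by_cases h : ∃ γ : ℝ → Torus d, IsGradientCurve u x γ
  · obtain ⟨-, ξ, hξ, hγ, -⟩ := h.choose_spec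
    obtain ⟨K, hK⟩ := hξ T
    refine (continuous_proj.comp_continuousOn hK.continuousOn).congr fun t ht => ?_
    simpa only [flow, dif_pos h, Function.comp_apply] using hγ t ht.1
  · simpa only [flow, dif_neg h] using continuousOn_const

theorem aemeasurable_flow (u : Torus d → ℝ) (x : Torus d) (T : ℝ) :
    AEMeasurable (fun t => flow u t x) (volume.restrict (Icc 0 T)) :=
  (continuousOn_flow u x T).aemeasurable measurableSet_Icc

theorem isProbabilityMeasure_occupationalMeasure (u : Torus d → ℝ) (x : Torus d) {T : ℝ}
    (hT : 0 < T) : IsProbabilityMeasure (occupationalMeasure u x T) := by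
  constructor
  rw [occupationalMeasure, Measure.smul_apply,
    Measure.map_apply_of_aemeasurable (aemeasurable_flow u x T) MeasurableSet.univ]
  simpa using ENNReal.inv_mul_cancel (by simpa using hT) ENNReal.ofReal_ne_top

/-- The occupational measure of a set is the fraction of time which the trajectory spends in it. -/
theorem measureReal_occupationalMeasure (u : Torus d → ℝ) (x : Torus d) {T : ℝ} (hT : 0 < T)
    {s : Set (Torus d)} (hs : MeasurableSet s) :
    (occupationalMeasure u x T).real s
      = 1 / T * volume.real {t : ℝ | t ∈ Icc 0 T ∧ flow u t x ∈ s} := by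
  have hset : (fun t => flow u t x) ⁻¹' s ∩ Icc 0 T = {t : ℝ | t ∈ Icc 0 T ∧ flow u t x ∈ s} :=
    inter_comm _ _
  rw [Measure.real, occupationalMeasure, Measure.smul_apply,
    Measure.map_apply_of_aemeasurable (aemeasurable_flow u x T) hs,
    Measure.restrict_apply' measurableSet_Icc, hset, smul_eq_mul, ENNReal.toReal_mul,
    ENNReal.toReal_inv, ENNReal.toReal_ofReal hT.le, one_div, Measure.real]

/-- By weak compactness, all limiting occupational measures give a continuous function the same
integral `c` precisely when its averages along the trajectory converge to `c`. -/
theorem forall_limitingMeasures_integral_eq_iff (u : Torus d → ℝ) (x : Torus d) {V : Torus d → ℝ}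
    (hV : Continuous V) (c : ℝ) :
    (∀ μ ∈ limitingMeasures u x, ∫ y, V y ∂(μ : Measure (Torus d)) = c) ↔
      Tendsto (fun T : ℝ => ∫ y, V y ∂(occupationalMeasure u x T)) atTop (𝓝 c) := by
  constructor
  · intro h
    refine tendsto_of_subseq_tendsto fun ns hns => ?_
    obtain ⟨N, hN⟩ := eventually_atTop.1 (hns.eventually_gt_atTop 0)
    obtain ⟨φ, hφ, hmono⟩ := strictMono_subseq_of_tendsto_atTop (hns.comp (tendsto_add_atTop_nat N))
    set T : ℕ → ℝ := fun k => ns (φ k + N) with hTdef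
    have hT0 : ∀ k, 0 < T k := fun k => hN _ (Nat.le_add_left _ _)
    have hTmono : StrictMono T := hmono
    have hTtop : Tendsto T atTop atTop :=
      hns.comp ((tendsto_add_atTop_nat N).comp hφ.tendsto_atTop)
    let ν : ℕ → ProbabilityMeasure (Torus d) := fun k =>
      ⟨occupationalMeasure u x (T k), isProbabilityMeasure_occupationalMeasure u x (hT0 k)⟩
    obtain ⟨μ, -, ψ, hψ, hlim⟩ := isCompact_univ.isSeqCompact (x := ν) fun n => mem_univ _
    have hweak : ∀ f : C(Torus d, ℝ),
        Tendsto (fun k => ∫ y, f y ∂(occupationalMeasure u x (T (ψ k)))) atTop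
          (𝓝 (∫ y, f y ∂(μ : Measure (Torus d)))) := fun f =>
      ProbabilityMeasure.tendsto_iff_forall_integral_tendsto.1 hlim
        (BoundedContinuousFunction.mkOfCompact f)
    have hμ : μ ∈ limitingMeasures u x :=
      ⟨fun k => T (ψ k), fun k => hT0 _, (hTmono.comp hψ).monotone,
        hTtop.comp hψ.tendsto_atTop, hweak⟩
    refine ⟨fun k => φ (ψ k) + N, ?_⟩
    have hlimV := hweak ⟨V, hV⟩
    simp only [ContinuousMap.coe_mk, h μ hμ] at hlimV
    exact hlimV
  · rintro h μ ⟨T, -, -, hT, hweak⟩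
    exact tendsto_nhds_unique (hweak ⟨V, hV⟩) (h.comp hT)

end MechHJ

theorem mainTheorem2 (d : ℕ) (V : MechHJ.Torus d → ℝ) (hV : MechHJ.IsCk 2 V)
    (u : MechHJ.Torus d → ℝ) (hu : MechHJ.Semiconcave u)
    (hsol : MechHJ.IsViscositySolution V (MechHJ.criticalConstant V) u)
    (x : MechHJ.Torus d) (hx : MechHJ.criticalTime u x = ⊤) :
    (∀ μ ∈ MechHJ.limitingMeasures u x,
        ∫ y, V y ∂(μ : Measure (MechHJ.Torus d)) = MechHJ.criticalConstant V) ↔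
    (∀ ε : ℝ, 0 < ε → Tendsto
        (fun T : ℝ => 1 / T * volume.real
          {t : ℝ | t ∈ Icc 0 T ∧ ε ≤ Metric.infDist (MechHJ.flow u t x) (MechHJ.argmaxSet V)})
        atTop (𝓝 0)) := by
  have hVc := hV.continuous
  have hle := hsol.le_level hVc
  obtain ⟨y₀, hy₀⟩ := hsol.exists_level_le
  have hM : ∀ y, y ∈ MechHJ.argmaxSet V ↔ V y = MechHJ.criticalConstant V := fun y =>
    ⟨fun hy => le_antisymm (hle y) (hy₀.trans (hy y₀)), fun hy z => (hle z).trans hy.ge⟩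
  have hne : (MechHJ.argmaxSet V).Nonempty := ⟨y₀, (hM y₀).2 (le_antisymm (hle y₀) hy₀)⟩
  have hprob : ∀ᶠ T : ℝ in atTop, IsProbabilityMeasure (MechHJ.occupationalMeasure u x T) :=
    (eventually_gt_atTop 0).mono fun T hT =>
      MechHJ.isProbabilityMeasure_occupationalMeasure u x hT
  rw [MechHJ.forall_limitingMeasures_integral_eq_iff u x hVc,
    tendsto_integral_iff_tendsto_measureReal hprob hVc hle hM hne]
  refine forall₂_congr fun ε _ => tendsto_congr' ?_
  filter_upwards [eventually_gt_atTop 0] with T hT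
  exact MechHJ.measureReal_occupationalMeasure u x hT
    (isClosed_le continuous_const (Metric.continuous_infDist_pt _)).measurableSet
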